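/- Theorem 2.1. Let $X, Y$ be finite-dimensional Euclidean spaces, $A : X \to Y$ a linear map with adjoint $A^*$, $b \in Y$, and $K \subseteq Y$ a closed convex cone (containing $0$) with dual cone $K^* = \{y \mid \langle y, s\rangle \ge 0 \ \forall s \in K\}$. Consider the conic system $P = \{x \in X \mid b - Ax \in K\}$, assumed nonempty. Call $P$ *well-behaved* if for every $c \in X$ for which $v := \sup\{\langle c, x\rangle \mid x \in P\}$ is finite there is $y \in K^*$ with $A^*y = c$ and $\langle b, y\rangle = v$. For a convex set $C$ and $x \in C$ let $$\operatorname{dir}(x,C) = \{y \mid x + \varepsilon y \in C \text{ for some } \varepsilon > 0\},\quad \operatorname{ldir}(x,C) = \operatorname{dir}(x,C) \cap -\operatorname{dir}(x,C),\quad \tan(x,C) = \operatorname{cl}\operatorname{dir}(x,C) \cap -\operatorname{cl}\operatorname{dir}(x,C).$$ For a set $S$ let $S^\perp$ be the orthogonal complement of its linear span. A *face* of $K$ is a convex set $E \subseteq K$ such that $x_1, x_2 \in K$ and $\tfrac12(x_1 + x_2) \in E$ imply $x_1, x_2 \in E$; its conjugate face is $E^\triangle = K^* \cap E^\perp$. A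 vector $u \in K^*$ is *strictly complementary* to $x \in K$ if $x \in \operatorname{ri} E$ and $u \in \operatorname{ri} E^\triangle$ for some face $E$ of $K$, where $\operatorname{ri}$ denotes relative interior. Write $\mathcal R$ and $\mathcal N$ for range and null space, and $\mathbb R_+ = [0,\infty)$. Let $(A,b) : X \times \mathbb R \to Y$, $(x, t) \mapsto Ax + tb$, and $\begin{pmatrix} A & b \\ 0 & 1\end{pmatrix} : X \times \mathbb R \to Y \times \mathbb R$, $(x,t) \mapsto (Ax + tb, t)$; their adjoints are $y \mapsto (A^*y, \langle b, y\rangle)$ and $(y,s) \mapsto (A^*y, \langle b,y\rangle + s)$. Let $z$ be a *maximum slack* in $P$, i.e. $z \in \operatorname{ri}\{s \in K \mid s = b - Ax \text{ for some } x \in X\}$. Consider the statements 1. $P$ is well-behaved. 2. The set $\begin{pmatrix} A & b \\ 0 & 1\end{pmatrix}^{*}(K^* \times \mathbb R_+)$ is closed. 3. The set $(A,b)^* K^*$ is closed. 4. $\mathcal R(A,b) \cap (\operatorname{cl}\operatorname{dir}(z,K) \setminus \operatorname{dir}(z,K)) = \emptyset$. 5. There is $u \in \mathcal N((A,b)^*)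 \cap K^*$ strictly complementary to $z$, and $\mathcal R(A,b) \cap (\tan(z,K) \setminus \operatorname{ldir}(z,K)) = \emptyset$. Then (1) $\Leftrightarrow$ (2), (3) $\Rightarrow$ (2), (2) $\Rightarrow$ (4), and (4) $\Leftrightarrow$ (5). In addition, let $F$ be the smallest face of $K$ that contains $z$. If $K^* + F^\perp$ is closed, then (1) through (5) are all equivalent. -/

import Mathlib

open scoped Pointwise InnerProductSpace

namespace ConicSystem

section ConvexSets

variable {E : Type*} [NormedAddCommGroup E] [InnerProductSpace ℝ E]

/-- `dir(x, C)`: the feasible directions at `x` in `C`. -/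
def dir (x : E) (C : Set E) : Set E := {y | ∃ ε : ℝ, 0 < ε ∧ x + ε • y ∈ C}

/-- `ldir(x, C) = dir(x, C) ∩ -dir(x, C)`. -/
def ldir (x : E) (C : Set E) : Set E := dir x C ∩ -dir x C

/-- `tan(x, C) = cl dir(x, C) ∩ -cl dir(x, C)`: the tangent space at `x` in `C`. -/
def tangent (x : E) (C : Set E) : Set E := closure (dir x C) ∩ -closure (dir x C)

/-- `S^⊥`: the orthogonal complement of the linear span of `S`. -/
noncomputable def perp (S : Set E) : Submodule ℝ E := (Submodule.span ℝ S)ᗮ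

/-- `F` is a face of `C`: a convex subset of `C` such that two points of `C` whose midpoint
lies in `F` both lie in `F`. -/
structure IsFace (C F : Set E) : Prop where
  subset : F ⊆ C
  convex : Convex ℝ F
  mem_of_midpoint : ∀ x ∈ C, ∀ y ∈ C, midpoint ℝ x y ∈ F → x ∈ F ∧ y ∈ F

/-- The smallest face of `C` that contains `x` (see `isLeast_minimalFace`). -/
def minimalFace (C : Set E) (x : E) : Set E := ⋂₀ {F | IsFace C F ∧ x ∈ F}

theorem isLeast_minimalFace {C : Set E} (hC : Convex ℝ C) {x : E} (hx : x ∈ C) :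
    IsLeast {F | IsFace C F ∧ x ∈ F} (minimalFace C x) := by
  refine ⟨⟨⟨?_, ?_, ?_⟩, ?_⟩, ?_⟩
  · exact Set.sInter_subset_of_mem ⟨⟨subset_rfl, hC, fun x hx y hy _ => ⟨hx, hy⟩⟩, hx⟩
  · exact convex_sInter fun F hF => hF.1.convex
  · intro a ha b hb hab
    exact ⟨fun F hF => (hF.1.mem_of_midpoint a ha b hb (hab F hF)).1,
      fun F hF => (hF.1.mem_of_midpoint a ha b hb (hab F hF)).2⟩
  · exact fun F hF => hF.2
  · exact fun F hF => Set.sInter_subset_of_mem hF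

variable [FiniteDimensional ℝ E]

/-- The dual cone `C^* = {y | ⟪x, y⟫ ≥ 0 for all x ∈ C}`, as a set (see `mem_dualCone`). -/
def dualCone (C : ProperCone ℝ E) : Set E := (ProperCone.innerDual (C : Set E) : Set E)

theorem mem_dualCone {C : ProperCone ℝ E} {y : E} :
    y ∈ dualCone C ↔ ∀ x ∈ C, 0 ≤ ⟪y, x⟫_ℝ := by
  simp only [dualCone, SetLike.mem_coe, ProperCone.mem_innerDual, real_inner_comm]

/-- The conjugate face `F^△ = C^* ∩ F^⊥` of a face `F` of `C`. -/
def conjugateFace (C : ProperCone ℝ E) (F : Set E) : Set E := dualCone C ∩ (perp F : Set E)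

/-- `u ∈ C^*` is strictly complementary to `x ∈ C`: for some face `F` of `C`, `x ∈ ri F` and
`u ∈ ri F^△`. -/
def StrictlyComplementary (C : ProperCone ℝ E) (u x : E) : Prop :=
  u ∈ dualCone C ∧ ∃ F : Set E, IsFace (C : Set E) F ∧
    x ∈ intrinsicInterior ℝ F ∧ u ∈ intrinsicInterior ℝ (conjugateFace C F)

end ConvexSets

section System

variable {X Y : Type*} [NormedAddCommGroup X] [InnerProductSpace ℝ X]
  [NormedAddCommGroup Y] [InnerProductSpace ℝ Y]

/-- The conic system `P = {x | A x ≤_K b}`. -/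
def feasibleSet (A : X →ₗ[ℝ] Y) (b : Y) (K : ProperCone ℝ Y) : Set X := {x | b - A x ∈ K}

/-- `z` is a maximum slack: a relative interior point of the set of slacks
`{b - A x | x} ∩ K`. -/
def IsMaximumSlack (A : X →ₗ[ℝ] Y) (b : Y) (K : ProperCone ℝ Y) (z : Y) : Prop :=
  z ∈ intrinsicInterior ℝ {s : Y | s ∈ K ∧ ∃ x : X, s = b - A x}

/-- The operator `(A, b) : X × ℝ → Y`, `(x, t) ↦ A x + t b`, on the euclidean product space. -/
noncomputable def rowOp (A : X →ₗ[ℝ] Y) (b : Y) : WithLp 2 (X × ℝ) →ₗ[ℝ] Y :=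
  (A.coprod (LinearMap.toSpanSingleton ℝ Y b)) ∘ₗ (WithLp.linearEquiv 2 ℝ (X × ℝ)).toLinearMap

/-- The operator `(A, b; 0, 1) : X × ℝ → Y × ℝ`, `(x, t) ↦ (A x + t b, t)`, between the euclidean
product spaces. -/
noncomputable def blockOp (A : X →ₗ[ℝ] Y) (b : Y) : WithLp 2 (X × ℝ) →ₗ[ℝ] WithLp 2 (Y × ℝ) :=
  (WithLp.linearEquiv 2 ℝ (Y × ℝ)).symm.toLinearMap ∘ₗ
    (((A.coprod (LinearMap.toSpanSingleton ℝ Y b)).prod (LinearMap.snd ℝ X ℝ)) ∘ₗ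
      (WithLp.linearEquiv 2 ℝ (X × ℝ)).toLinearMap)

theorem rowOp_apply (A : X →ₗ[ℝ] Y) (b : Y) (p : WithLp 2 (X × ℝ)) :
    rowOp A b p = A p.fst + p.snd • b := by
  simp [rowOp]

theorem blockOp_apply (A : X →ₗ[ℝ] Y) (b : Y) (p : WithLp 2 (X × ℝ)) :
    blockOp A b p = WithLp.toLp 2 (A p.fst + p.snd • b, p.snd) := by
  simp [blockOp]

/-- `K^* × ℝ₊`, inside the euclidean product space. -/
def dualConeProd [FiniteDimensional ℝ Y] (K : ProperCone ℝ Y) : Set (WithLp 2 (Y × ℝ)) :=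
  {q | q.fst ∈ dualCone K ∧ 0 ≤ q.snd}

variable [FiniteDimensional ℝ X] [FiniteDimensional ℝ Y]

/-- `(A, b)^* y = (A^* y, ⟪b, y⟫)`. -/
theorem adjoint_rowOp_apply (A : X →ₗ[ℝ] Y) (b y : Y) :
    LinearMap.adjoint (rowOp A b) y = WithLp.toLp 2 (LinearMap.adjoint A y, ⟪b, y⟫_ℝ) := by
  refine ext_inner_right ℝ fun p => ?_
  rw [LinearMap.adjoint_inner_left, rowOp_apply, WithLp.prod_inner_apply, inner_add_right,
    inner_smul_right]
  simp [LinearMap.adjoint_inner_left, real_inner_comm]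

/-- `(A, b; 0, 1)^* (y, s) = (A^* y, ⟪b, y⟫ + s)`. -/
theorem adjoint_blockOp_apply (A : X →ₗ[ℝ] Y) (b : Y) (q : WithLp 2 (Y × ℝ)) :
    LinearMap.adjoint (blockOp A b) q =
      WithLp.toLp 2 (LinearMap.adjoint A q.fst, ⟪b, q.fst⟫_ℝ + q.snd) := by
  refine ext_inner_right ℝ fun p => ?_
  rw [LinearMap.adjoint_inner_left, blockOp_apply, WithLp.prod_inner_apply,
    WithLp.prod_inner_apply]
  simp [LinearMap.adjoint_inner_left, real_inner_comm, inner_add_right, inner_smul_right]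
  ring

/-- `P` is well-behaved: whenever `sup {⟪c, x⟫ | x ∈ P}` is a (finite) real number `v`, the dual
`inf {⟪b, y⟫ | y ∈ K^*, A^* y = c}` has a feasible solution with value `v`. -/
def WellBehaved (A : X →ₗ[ℝ] Y) (b : Y) (K : ProperCone ℝ Y) : Prop :=
  ∀ (c : X) (v : ℝ), IsLUB ((fun x => ⟪c, x⟫_ℝ) '' feasibleSet A b K) v →
    ∃ y ∈ dualCone K, LinearMap.adjoint A y = c ∧ ⟪b, y⟫_ℝ = v

/-- The set `(A, b; 0, 1)^* (K^* × ℝ₊)` is closed. -/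
def BlockImageClosed (A : X →ₗ[ℝ] Y) (b : Y) (K : ProperCone ℝ Y) : Prop :=
  IsClosed (LinearMap.adjoint (blockOp A b) '' dualConeProd K)

/-- The set `(A, b)^* K^*` is closed. -/
def RowImageClosed (A : X →ₗ[ℝ] Y) (b : Y) (K : ProperCone ℝ Y) : Prop :=
  IsClosed (LinearMap.adjoint (rowOp A b) '' dualCone K)

/-- `R(A, b) ∩ (cl dir(z, K) \ dir(z, K)) = ∅`. -/
def FrontierCondition (A : X →ₗ[ℝ] Y) (b : Y) (K : ProperCone ℝ Y) (z : Y) : Prop :=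
  (LinearMap.range (rowOp A b) : Set Y) ∩ (closure (dir z (K : Set Y)) \ dir z (K : Set Y)) = ∅

/-- There is `u ∈ N((A, b)^*) ∩ K^*` strictly complementary to `z`, and
`R(A, b) ∩ (tan(z, K) \ ldir(z, K)) = ∅`. -/
def TangentCondition (A : X →ₗ[ℝ] Y) (b : Y) (K : ProperCone ℝ Y) (z : Y) : Prop :=
  (∃ u ∈ (LinearMap.ker (LinearMap.adjoint (rowOp A b)) : Set Y) ∩ dualCone K,
    StrictlyComplementary K u z) ∧
  (LinearMap.range (rowOp A b) : Set Y) ∩ (tangent z (K : Set Y) \ ldir z (K : Set Y)) = ∅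

end System

end ConicSystem

/-! Let `H` be the range of `(A, b)`. By the bipolar theorem, a pair `(c, v)` lies in the closure of
the block image exactly when it is nonnegative on the pairs `(x, t)` with `A x + t b ∈ K` and `t ≥
0`. For nonempty `P`, this says that `⟪c, x⟫ ≤ v` on `P`. Closedness therefore means that all such
bounds have dual certificates, which is well-behavedness.

The geometric conditions rest on one fact: a maximum slack `z` dominates `K ∩ H`, in that each `p`
there has some `t • z - p ∈ K`. Moreover `cl dir(z, K)` is dual to `K^* ∩ z^⊥`, and strict
complementarity to `z` means lying in the relative interior of that cone. A theorem of the
alternative then relates the frontier and tangent conditions (`frontier_iff_tangent`).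

If `K^* + F^⊥` is closed, the tangent condition gives `(K ∩ H)^* ⊆ K^* + H^⊥`
(`exists_dualCone_sub_mem_orthogonal`), hence closedness of the row image. -/

namespace ConicSystem

/-! ### Relative interiors of convex sets -/

section RelativeInterior

variable {E : Type*} [NormedAddCommGroup E] [NormedSpace ℝ E]

theorem mem_intrinsicInterior_iff_dist {C : Set E} {x : E} :
    x ∈ intrinsicInterior ℝ C ↔ x ∈ affineSpan ℝ C ∧
      ∃ δ > 0, ∀ y ∈ affineSpan ℝ C, dist y x < δ → y ∈ C := by
  rw [mem_intrinsicInterior]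
  constructor
  · rintro ⟨y, hy, rfl⟩
    obtain ⟨δ, hδ, h⟩ := Metric.mem_nhds_iff.1 (mem_interior_iff_mem_nhds.1 hy)
    exact ⟨y.2, δ, hδ, fun w hw hd =>
      h (show (⟨w, hw⟩ : affineSpan ℝ C) ∈ Metric.ball y δ from hd)⟩
  · rintro ⟨hx, δ, hδ, h⟩
    exact ⟨⟨x, hx⟩, mem_interior_iff_mem_nhds.2
      (Metric.mem_nhds_iff.2 ⟨δ, hδ, fun w hw => h w w.2 hw⟩), rfl⟩

/-- From a relative interior point, segments can be prolonged. -/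
theorem exists_add_smul_sub_mem {C : Set E} {p q : E} (hp : p ∈ intrinsicInterior ℝ C)
    (hq : q ∈ C) : ∃ ε : ℝ, 0 < ε ∧ p + ε • (p - q) ∈ C := by
  obtain ⟨hpC, δ, hδ, h⟩ := mem_intrinsicInterior_iff_dist.1 hp
  have hpos : 0 < ‖p - q‖ + 1 := by positivity
  refine ⟨δ / (‖p - q‖ + 1), by positivity, h _ ?_ ?_⟩
  · have := AffineMap.lineMap_mem (-(δ / (‖p - q‖ + 1))) hpC (subset_affineSpan ℝ C hq)
    rw [AffineMap.lineMap_apply_module'] at this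
    convert this using 1
    module
  · rw [dist_eq_norm, add_sub_cancel_left, norm_smul, Real.norm_of_nonneg (by positivity),
      div_mul_eq_mul_div, div_lt_iff₀ hpos]
    nlinarith

/-- A point of a convex set from which all segments can be prolonged is relatively interior. -/
theorem mem_intrinsicInterior_of_forall_exists [FiniteDimensional ℝ E] {C : Set E}
    (hC : Convex ℝ C) {p : E} (hp : p ∈ C)
    (h : ∀ q ∈ C, ∃ ε : ℝ, 0 < ε ∧ p + ε • (p - q) ∈ C) : p ∈ intrinsicInterior ℝ C := by
  obtain ⟨q, hq⟩ := Set.Nonempty.intrinsicInterior hC ⟨p, hp⟩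
  obtain ⟨ε, hε, hr⟩ := h q (intrinsicInterior_subset hq)
  obtain ⟨-, δ, hδ, hball⟩ := mem_intrinsicInterior_iff_dist.1 hq
  have hpC := subset_affineSpan ℝ C hp
  have hqC := subset_affineSpan ℝ C (intrinsicInterior_subset hq)
  have hε1 : 0 < 1 + ε := by positivity
  -- With `r = p + ε • (p - q)`, the homothety centred at `r` of ratio `ε / (1 + ε)` sends `q` to
  -- `p`, so it shrinks the `δ`-ball at `q` to this radius.
  refine mem_intrinsicInterior_iff_dist.2 ⟨hpC, δ * (ε / (1 + ε)), by positivity, fun x hx hd => ?_⟩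
  have hy : q + ((1 + ε) / ε) • (x - p) ∈ C := by
    refine hball _ ?_ ?_
    · rw [add_comm]
      have := (affineSpan ℝ C).smul_vsub_vadd_mem ((1 + ε) / ε) hx hpC hqC
      simpa using this
    · rw [dist_eq_norm, add_sub_cancel_left, norm_smul, Real.norm_of_nonneg (by positivity),
        ← dist_eq_norm, div_mul_eq_mul_div, div_lt_iff₀ hε]
      rw [← mul_div_assoc, lt_div_iff₀ hε1] at hd
      linarith
  have := hC hy hr (a := ε / (1 + ε)) (b := 1 / (1 + ε)) (by positivity) (by positivity)
    (by field_simp; ring)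
  convert this using 1
  match_scalars <;> field_simp <;> ring

theorem eq_univ_of_convex_of_dense [FiniteDimensional ℝ E] {s : Set E} (hs : Convex ℝ s)
    (hd : Dense s) : s = Set.univ := by
  have htop : affineSpan ℝ s = ⊤ := by
    have hcl : IsClosed (affineSpan ℝ s : Set E) := AffineSubspace.closed_of_finiteDimensional _
    have := closure_minimal (subset_affineSpan ℝ s) hcl
    rw [hd.closure_eq] at this
    exact SetLike.coe_injective (Set.univ_subset_iff.1 this)
  have hne := hs.interior_nonempty_iff_affineSpan_eq_top.2 htop
  have := hs.interior_closure_eq_interior_of_nonempty_interior hne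
  rw [hd.closure_eq, interior_univ] at this
  exact Set.univ_subset_iff.1 (this ▸ interior_subset)

end RelativeInterior

/-! ### Bipolarity and a theorem of the alternative -/

section Duality

variable {E : Type*} [NormedAddCommGroup E] [InnerProductSpace ℝ E]

theorem mem_perp {S : Set E} {y : E} : y ∈ perp S ↔ ∀ s ∈ S, ⟪y, s⟫_ℝ = 0 := by
  rw [perp, Submodule.mem_orthogonal']
  refine ⟨fun h s hs => h s (Submodule.subset_span hs), fun h s hs => ?_⟩
  induction hs using Submodule.span_induction with
  | mem x hx => exact h x hx
  | zero => simp
  | add x y _ _ hx hy => rw [inner_add_right, hx, hy, add_zero]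
  | smul a x _ hx => rw [inner_smul_right, hx, mul_zero]

variable [FiniteDimensional ℝ E]

/-- The bipolar theorem for a convex cone that need not be closed. -/
theorem mem_closure_iff_forall_inner_nonneg (C : PointedCone ℝ E) {x : E} :
    x ∈ closure (C : Set E) ↔ ∀ y, (∀ c ∈ C, 0 ≤ ⟪y, c⟫_ℝ) → 0 ≤ ⟪y, x⟫_ℝ := by
  have := FiniteDimensional.complete ℝ E
  constructor
  · intro hx y hy
    have hcl : IsClosed {v : E | 0 ≤ ⟪y, v⟫_ℝ} := isClosed_le (by fun_prop) (by fun_prop)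
    exact closure_minimal hy hcl hx
  · intro h
    by_contra hx
    obtain ⟨y, hy, hlt⟩ := ProperCone.hyperplane_separation'
      (⟨C.closure, isClosed_closure⟩ : ProperCone ℝ E) hx
    rw [real_inner_comm] at hlt
    refine hlt.not_ge (h y fun c hc => ?_)
    rw [real_inner_comm]
    exact hy c (subset_closure hc)

theorem mem_iff_forall_dualCone (K : ProperCone ℝ E) {x : E} :
    x ∈ K ↔ ∀ y ∈ dualCone K, 0 ≤ ⟪y, x⟫_ℝ := by
  have := mem_closure_iff_forall_inner_nonneg K.toPointedCone (x := x)
  rw [show closure (K.toPointedCone : Set E) = (K : Set E) from K.isClosed.closure_eq] at this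
  simp only [mem_dualCone]
  exact this

/-- If every point of `H` in the dual of the convex cone `D` is orthogonal to `D`, then each
element of `D` can be moved into `Hᗮ` by adding an element of `D`. -/
theorem exists_add_mem_orthogonal (D : PointedCone ℝ E) (H : Submodule ℝ E)
    (hD : ∀ h ∈ H, (∀ d ∈ D, 0 ≤ ⟪d, h⟫_ℝ) → ∀ d ∈ D, ⟪d, h⟫_ℝ = 0) {d₀ : E} (hd₀ : d₀ ∈ D) :
    ∃ d ∈ D, d₀ + d ∈ Hᗮ := by
  -- Adding `L` makes `D + Hᗮ` dense: a vector of the dual cone lies in `H`, so by `hD` in `L`, and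
  -- it is orthogonal to `L`, so it is zero. A dense convex set is the whole space, which places
  -- `-d₀` in the sum.
  set L : Submodule ℝ E := H ⊓ perp (D : Set E) with hL
  set W : Submodule ℝ E := Hᗮ ⊔ L with hW
  let C : PointedCone ℝ E := D ⊔ (W.restrictScalars _)
  have hdense : Dense (C : Set E) := by
    intro x
    rw [mem_closure_iff_forall_inner_nonneg]
    intro y hy
    have hyW : ∀ w ∈ W, ⟪y, w⟫_ℝ = 0 := by
      intro w hw
      have h1 := hy w (Submodule.mem_sup_right (show w ∈ W.restrictScalars _ from hw))
      have h2 := hy (-w) (Submodule.mem_sup_right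
        (show -w ∈ W.restrictScalars _ from W.neg_mem hw))
      rw [inner_neg_right] at h2
      linarith
    have hyH : y ∈ H := by
      rw [← H.orthogonal_orthogonal, Submodule.mem_orthogonal']
      exact fun w hw => hyW w (Submodule.mem_sup_left hw)
    have hyD : ∀ d ∈ D, ⟪d, y⟫_ℝ = 0 := by
      refine hD y hyH fun d hd => ?_
      rw [real_inner_comm]
      exact hy d (Submodule.mem_sup_left hd)
    have hyL : y ∈ L := ⟨hyH, mem_perp.2 fun d hd => by rw [real_inner_comm]; exact hyD d hd⟩
    have := hyW y (Submodule.mem_sup_right hyL)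
    rw [inner_self_eq_zero.1 this, inner_zero_left]
  have huniv := eq_univ_of_convex_of_dense C.convex hdense
  have hmem : -d₀ ∈ C := by
    change -d₀ ∈ (C : Set E)
    rw [huniv]; trivial
  obtain ⟨d, hd, w, hw, hdw⟩ := Submodule.mem_sup.1 hmem
  obtain ⟨n, hn, l, hl, rfl⟩ := Submodule.mem_sup.1 (show w ∈ Hᗮ ⊔ L from hw)
  -- The `L`-component is orthogonal to every other term of the decomposition of `-d₀`, so it
  -- vanishes.
  have hl0 : l = 0 := by
    have h1 : ⟪l, d₀⟫_ℝ = 0 := mem_perp.1 hl.2 d₀ hd₀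
    have h2 : ⟪l, d⟫_ℝ = 0 := mem_perp.1 hl.2 d hd
    have h3 : ⟪l, n⟫_ℝ = 0 := (Submodule.mem_orthogonal H n).1 hn l hl.1
    have h4 : l = -d₀ - d - n := by rw [← hdw]; abel
    have h5 : ⟪l, l⟫_ℝ = 0 := by
      nth_rewrite 2 [h4]
      rw [inner_sub_right, inner_sub_right, inner_neg_right, h1, h2, h3]
      simp
    exact inner_self_eq_zero.1 h5
  refine ⟨d, hd, ?_⟩
  have : d₀ + d = -n := by
    rw [hl0, add_zero] at hdw
    rw [← neg_eq_iff_eq_neg.2 hdw]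
    abel
  rw [this]
  exact Submodule.neg_mem _ hn

end Duality

end ConicSystem

namespace ConicSystem

/-! ### Faces, feasible directions and tangent spaces of a closed convex cone -/

section Cones

variable {E : Type*} [NormedAddCommGroup E] [InnerProductSpace ℝ E]

theorem mem_of_mem_of_eq {K : ProperCone ℝ E} {x y : E} (hx : x ∈ K) (h : x = y) : y ∈ K :=
  h ▸ hx

theorem mem_dir_iff {K : ProperCone ℝ E} {z h : E} (hz : z ∈ K) :
    h ∈ dir z (K : Set E) ↔ ∃ t : ℝ, h + t • z ∈ K := by
  constructor
  · rintro ⟨ε, hε, h⟩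
    refine ⟨ε⁻¹, ?_⟩
    have := K.smul_mem h (inv_nonneg.2 hε.le)
    rwa [smul_add, smul_smul, inv_mul_cancel₀ hε.ne', one_smul, add_comm] at this
  · rintro ⟨t, h⟩
    have hs : 0 < |t| + 1 := by positivity
    refine ⟨(|t| + 1)⁻¹, inv_pos.2 hs, ?_⟩
    refine mem_of_mem_of_eq (K.smul_mem (K.add_mem h (K.smul_mem hz
      (show 0 ≤ |t| + 1 - t by linarith [le_abs_self t]))) (inv_nonneg.2 hs.le)) ?_
    match_scalars <;> field_simp
    ring

theorem exists_pos_smul_sub_mem {K : ProperCone ℝ E} {z p : E} (hz : z ∈ K)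
    (h : ∃ t : ℝ, t • z - p ∈ K) : ∃ t : ℝ, 0 < t ∧ t • z - p ∈ K := by
  obtain ⟨t, ht⟩ := h
  refine ⟨|t| + 1, by positivity, ?_⟩
  exact mem_of_mem_of_eq
    (K.add_mem ht (K.smul_mem hz (show 0 ≤ |t| + 1 - t by linarith [le_abs_self t]))) (by module)

theorem mem_ldir_iff {K : ProperCone ℝ E} {z h : E} (hz : z ∈ K) :
    h ∈ ldir z (K : Set E) ↔ (∃ t : ℝ, h + t • z ∈ K) ∧ ∃ t : ℝ, t • z - h ∈ K := by
  simp only [ldir, Set.mem_inter_iff, Set.mem_neg, mem_dir_iff hz, neg_add_eq_sub]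

/-- `ldir(z, K)` as a subspace. -/
def ldirSubmodule (K : ProperCone ℝ E) {z : E} (hz : z ∈ K) : Submodule ℝ E where
  carrier := ldir z (K : Set E)
  zero_mem' := (mem_ldir_iff hz).2 ⟨⟨0, by simp⟩, 0, by simp⟩
  add_mem' {x y} hx hy := by
    rw [mem_ldir_iff hz] at *
    obtain ⟨⟨a, ha⟩, b, hb⟩ := hx
    obtain ⟨⟨c, hc⟩, d, hd⟩ := hy
    refine ⟨⟨a + c, ?_⟩, b + d, ?_⟩
    · exact mem_of_mem_of_eq (K.add_mem ha hc) (by module)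
    · exact mem_of_mem_of_eq (K.add_mem hb hd) (by module)
  smul_mem' r x hx := by
    rw [mem_ldir_iff hz] at *
    obtain ⟨⟨a, ha⟩, b, hb⟩ := hx
    rcases le_total 0 r with hr | hr
    · refine ⟨⟨r * a, ?_⟩, r * b, ?_⟩
      · exact mem_of_mem_of_eq (K.smul_mem ha hr) (by module)
      · exact mem_of_mem_of_eq (K.smul_mem hb hr) (by module)
    · have hr' : 0 ≤ -r := neg_nonneg.2 hr
      refine ⟨⟨-r * b, ?_⟩, -r * a, ?_⟩
      · exact mem_of_mem_of_eq (K.smul_mem hb hr') (by module)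
      · exact mem_of_mem_of_eq (K.smul_mem ha hr') (by module)

theorem mem_ldir_of_mem {K : ProperCone ℝ E} {z p : E} (hz : z ∈ K) (hp : p ∈ K)
    (h : ∃ t : ℝ, t • z - p ∈ K) : p ∈ ldir z (K : Set E) :=
  (mem_ldir_iff hz).2 ⟨⟨0, by simpa using hp⟩, h⟩

theorem self_mem_ldir {K : ProperCone ℝ E} {z : E} (hz : z ∈ K) : z ∈ ldir z (K : Set E) :=
  mem_ldir_of_mem hz hz ⟨1, by simp⟩

/-- The smallest face of a closed convex cone that contains `z` is cut out by `ldir(z, K)`. -/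
theorem minimalFace_eq {K : ProperCone ℝ E} {z : E} (hz : z ∈ K) :
    minimalFace (K : Set E) z = (K : Set E) ∩ ldir z (K : Set E) := by
  apply Set.Subset.antisymm
  · refine Set.sInter_subset_of_mem ⟨⟨Set.inter_subset_left,
      K.convex.inter (ldirSubmodule K hz).convex, ?_⟩, hz, self_mem_ldir hz⟩
    have key : ∀ x ∈ K, ∀ y ∈ K, midpoint ℝ x y ∈ ldir z (K : Set E) →
        x ∈ ldir z (K : Set E) := by
      intro x hx y hy h
      obtain ⟨-, t, ht⟩ := (mem_ldir_iff hz).1 h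
      refine mem_ldir_of_mem hz hx ⟨2 * t, ?_⟩
      refine mem_of_mem_of_eq (K.add_mem (K.smul_mem ht (zero_le_two (α := ℝ))) hy) ?_
      rw [midpoint_eq_smul_add, invOf_eq_inv]
      module
    intro x hx y hy h
    exact ⟨⟨hx, key x hx y hy h.2⟩, hy, key y hy x hx (midpoint_comm (R := ℝ) x y ▸ h.2)⟩
  · rintro p ⟨hp, hpl⟩ F ⟨hF, hzF⟩
    obtain ⟨t, ht, htp⟩ := exists_pos_smul_sub_mem hz ((mem_ldir_iff hz).1 hpl).2
    -- A face is not assumed to be a cone. Viewing `x` as the midpoint of `0` and `2 • x` puts all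
    -- `2 ^ n • z` in `F`, hence also `t • z`, which is the midpoint of `2 • p` and `2 • (t • z -
    -- p)`.
    have hmid (x : E) : midpoint ℝ 0 ((2 : ℝ) • x) = x := by
      rw [midpoint_eq_smul_add, invOf_eq_inv]; module
    have hdouble : ∀ x ∈ F, (0 : E) ∈ F ∧ (2 : ℝ) • x ∈ F := fun x hx =>
      hF.mem_of_midpoint 0 K.zero_mem _ (K.smul_mem (hF.subset hx) zero_le_two)
        ((hmid x).symm ▸ hx)
    have h0 := (hdouble z hzF).1
    have hpow (n : ℕ) : ((2 : ℝ) ^ n) • z ∈ F := by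
      induction n with
      | zero => simpa using hzF
      | succ n ih => rw [pow_succ', mul_smul]; exact (hdouble _ ih).2
    have hshrink : ∀ x ∈ F, ∀ c : ℝ, 0 ≤ c → c ≤ 1 → c • x ∈ F := fun x hx c h1 h2 =>
      hF.convex.smul_mem_of_zero_mem h0 hx ⟨h1, h2⟩
    obtain ⟨n, hn⟩ := pow_unbounded_of_one_lt t (one_lt_two (α := ℝ))
    have htz : t • z ∈ F := by
      have := hshrink _ (hpow n) (t / 2 ^ n) (by positivity)
        ((div_le_one (by positivity)).2 hn.le)
      rwa [smul_smul, div_mul_cancel₀ _ (by positivity)] at this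
    have h2p : (2 : ℝ) • p ∈ F := by
      refine (hF.mem_of_midpoint _ (K.smul_mem hp zero_le_two) _
        (K.smul_mem htp zero_le_two) ?_).1
      convert htz using 1
      rw [midpoint_eq_smul_add, invOf_eq_inv]
      module
    have := hshrink _ h2p (1 / 2) (by norm_num) (by norm_num)
    rwa [smul_smul, one_div_mul_cancel two_ne_zero, one_smul] at this

theorem perp_minimalFace {K : ProperCone ℝ E} {z : E} (hz : z ∈ K) :
    perp (minimalFace (K : Set E) z) = (ldirSubmodule K hz)ᗮ := by
  ext y
  rw [mem_perp, minimalFace_eq hz, Submodule.mem_orthogonal']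
  refine ⟨fun h x hx => ?_, fun h x hx => h x hx.2⟩
  obtain ⟨t, ht⟩ := ((mem_ldir_iff hz).1 hx).1
  have hzy := h z ⟨hz, self_mem_ldir hz⟩
  have := h _ ⟨ht, (ldirSubmodule K hz).add_mem hx
    ((ldirSubmodule K hz).smul_mem t (self_mem_ldir hz))⟩
  rwa [inner_add_right, inner_smul_right, hzy, mul_zero, add_zero] at this

variable [FiniteDimensional ℝ E]

theorem mem_intrinsicInterior_minimalFace {K : ProperCone ℝ E} {z : E} (hz : z ∈ K) :
    z ∈ intrinsicInterior ℝ (minimalFace (K : Set E) z) := by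
  rw [minimalFace_eq hz]
  refine mem_intrinsicInterior_of_forall_exists
    (K.convex.inter (ldirSubmodule K hz).convex) ⟨hz, self_mem_ldir hz⟩ ?_
  rintro q ⟨-, hq⟩
  have hzq : z - q ∈ ldirSubmodule K hz := (ldirSubmodule K hz).sub_mem (self_mem_ldir hz) hq
  obtain ⟨ε, hε, h⟩ := hzq.1
  exact ⟨ε, hε, h, (ldirSubmodule K hz).add_mem (self_mem_ldir hz)
    ((ldirSubmodule K hz).smul_mem ε hzq)⟩

/-- The face `K^* ∩ z^⊥` of the dual cone exposed by `z`. -/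
noncomputable def dualFace (K : ProperCone ℝ E) (z : E) : PointedCone ℝ E :=
  (ProperCone.innerDual (K : Set E)).toPointedCone ⊓ (perp {z}).restrictScalars _

theorem mem_dualFace {K : ProperCone ℝ E} {z y : E} :
    y ∈ dualFace K z ↔ y ∈ dualCone K ∧ ⟪y, z⟫_ℝ = 0 := by
  change y ∈ dualCone K ∧ y ∈ perp {z} ↔ _
  rw [mem_perp]
  simp

/-- A functional in `K^*` vanishing at `z` is nonnegative at `q` and at a point beyond `z` on the
line from `q`, so it vanishes at `q`. Thus the conjugate face depends only on `z`. -/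
theorem conjugateFace_eq {K : ProperCone ℝ E} {F : Set E} {z : E} (hF : IsFace (K : Set E) F)
    (hz : z ∈ intrinsicInterior ℝ F) : conjugateFace K F = dualFace K z := by
  ext y
  rw [SetLike.mem_coe, mem_dualFace, conjugateFace, Set.mem_inter_iff, SetLike.mem_coe, mem_perp]
  refine and_congr_right fun hy => ⟨fun h => h z (intrinsicInterior_subset hz), fun h q hq => ?_⟩
  obtain ⟨ε, hε, hm⟩ := exists_add_smul_sub_mem hz hq
  have h1 := mem_dualCone.1 hy _ (hF.subset hm)
  have h2 := mem_dualCone.1 hy _ (hF.subset hq)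
  rw [inner_add_right, inner_smul_right, inner_sub_right, h] at h1
  nlinarith

theorem strictlyComplementary_iff {K : ProperCone ℝ E} {z u : E} (hz : z ∈ K) :
    StrictlyComplementary K u z ↔ u ∈ intrinsicInterior ℝ (dualFace K z : Set E) := by
  constructor
  · rintro ⟨-, F, hF, hzF, hu⟩
    rwa [conjugateFace_eq hF hzF] at hu
  · intro hu
    have hF := (isLeast_minimalFace K.convex hz).1.1
    have hzF := mem_intrinsicInterior_minimalFace hz
    refine ⟨(mem_dualFace.1 (intrinsicInterior_subset hu)).1, _, hF, hzF, ?_⟩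
    rwa [conjugateFace_eq hF hzF]

/-- Here `dir(z, K) = K + ℝ z`, whose dual is `K^* ∩ z^⊥`; the bipolar theorem does the rest. -/
theorem mem_closure_dir_iff {K : ProperCone ℝ E} {z h : E} (hz : z ∈ K) :
    h ∈ closure (dir z (K : Set E)) ↔ ∀ y ∈ dualFace K z, 0 ≤ ⟪y, h⟫_ℝ := by
  let C : PointedCone ℝ E := K.toPointedCone ⊔ (Submodule.span ℝ {z}).restrictScalars _
  have hC : (C : Set E) = dir z (K : Set E) := by
    ext x
    rw [mem_dir_iff hz, SetLike.mem_coe, Submodule.mem_sup]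
    constructor
    · rintro ⟨k, hk, w, hw, rfl⟩
      obtain ⟨t, rfl⟩ := Submodule.mem_span_singleton.1 (show w ∈ Submodule.span ℝ {z} from hw)
      refine ⟨-t, ?_⟩
      convert show k ∈ K from hk using 1
      module
    · rintro ⟨t, ht⟩
      exact ⟨_, ht, -(t • z), Submodule.neg_mem _
        (Submodule.smul_mem _ _ (Submodule.mem_span_singleton_self z)), by abel⟩
  rw [← hC, mem_closure_iff_forall_inner_nonneg]
  refine forall_congr' fun y => imp_congr_left ?_
  rw [mem_dualFace, mem_dualCone]
  constructor
  · intro hy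
    have hspan (w : E) (hw : w ∈ Submodule.span ℝ {z}) : w ∈ C := Submodule.mem_sup_right hw
    have h1 := hy z (hspan _ (Submodule.mem_span_singleton_self z))
    have h2 := hy (-z) (hspan _ (Submodule.neg_mem _ (Submodule.mem_span_singleton_self z)))
    rw [inner_neg_right] at h2
    exact ⟨fun x hx => hy x (Submodule.mem_sup_left hx), by linarith⟩
  · rintro ⟨hy, hyz⟩ c hc
    obtain ⟨k, hk, w, hw, rfl⟩ := Submodule.mem_sup.1 hc
    obtain ⟨t, rfl⟩ := Submodule.mem_span_singleton.1 (show w ∈ Submodule.span ℝ {z} from hw)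
    rw [inner_add_right, inner_smul_right, hyz, mul_zero, add_zero]
    exact hy k hk

theorem mem_tangent_iff {K : ProperCone ℝ E} {z h : E} (hz : z ∈ K) :
    h ∈ tangent z (K : Set E) ↔ ∀ y ∈ dualFace K z, ⟪y, h⟫_ℝ = 0 := by
  simp only [tangent, Set.mem_inter_iff, Set.mem_neg, mem_closure_dir_iff hz, inner_neg_right,
    ← forall_and]
  exact forall_congr' fun y => forall_congr' fun _ =>
    ⟨fun h => by linarith [h.1, h.2], fun h => by simp [h]⟩

/-- When `z` dominates all of `K`, every feasible direction is reversible, so the directions form a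
subspace. -/
theorem isClosed_dir_of_forall_exists {K : ProperCone ℝ E} {z : E} (hz : z ∈ K)
    (hK : ∀ p ∈ K, ∃ t : ℝ, t • z - p ∈ K) : IsClosed (dir z (K : Set E)) := by
  have : dir z (K : Set E) = (ldirSubmodule K hz : Set E) := by
    refine Set.Subset.antisymm (fun h hh => ⟨hh, ?_⟩) fun h hh => hh.1
    obtain ⟨t, ht⟩ := (mem_dir_iff hz).1 hh
    obtain ⟨s, hs⟩ := hK _ ht
    refine (mem_dir_iff hz).2 ⟨s - t, ?_⟩
    convert hs using 1
    module
  rw [this]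
  exact Submodule.closed_of_finiteDimensional _

theorem add_mem_intrinsicInterior {D : PointedCone ℝ E} {u d : E}
    (hu : u ∈ intrinsicInterior ℝ (D : Set E)) (hd : d ∈ D) :
    u + d ∈ intrinsicInterior ℝ (D : Set E) := by
  refine mem_intrinsicInterior_of_forall_exists D.convex
    (D.add_mem (intrinsicInterior_subset hu) hd) fun q hq => ?_
  obtain ⟨ε, hε, h⟩ := exists_add_smul_sub_mem hu hq
  refine ⟨ε, hε, ?_⟩
  have h1 : (1 + ε) • d ∈ D := D.smul_mem (show 0 ≤ 1 + ε by positivity) hd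
  have h2 : u + d + ε • (u + d - q) = u + ε • (u - q) + (1 + ε) • d := by module
  rw [h2]
  exact D.add_mem h h1

/-- The equivalence between the frontier condition and the tangent condition, for a subspace `H`
in which `z` is algebraically relatively interior to `K ∩ H`. -/
theorem frontier_iff_tangent {K : ProperCone ℝ E} {z : E} (hz : z ∈ K) {H : Submodule ℝ E}
    (hzH : z ∈ H) (hK : ∀ p ∈ K, p ∈ H → ∃ t : ℝ, t • z - p ∈ K) :
    (H : Set E) ∩ (closure (dir z (K : Set E)) \ dir z (K : Set E)) = ∅ ↔
      (∃ u ∈ (Hᗮ : Set E) ∩ dualCone K, StrictlyComplementary K u z) ∧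
        (H : Set E) ∩ (tangent z (K : Set E) \ ldir z (K : Set E)) = ∅ := by
  simp only [Set.eq_empty_iff_forall_notMem, Set.mem_inter_iff, Set.mem_sdiff, SetLike.mem_coe,
    not_and, not_not, strictlyComplementary_iff hz]
  constructor
  · intro h
    refine ⟨?_, fun x hxH hx => ⟨h x hxH hx.1, h (-x) (H.neg_mem hxH) hx.2⟩⟩
    have hD : ∀ x ∈ H, (∀ y ∈ dualFace K z, 0 ≤ ⟪y, x⟫_ℝ) →
        ∀ y ∈ dualFace K z, ⟪y, x⟫_ℝ = 0 := by
      intro x hx hnn y hy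
      obtain ⟨t, ht⟩ := (mem_dir_iff hz).1 (h x hx ((mem_closure_dir_iff hz).2 hnn))
      obtain ⟨s, hs⟩ := hK _ ht (H.add_mem hx (H.smul_mem t hzH))
      have h1 := hnn y hy
      have h2 := mem_dualCone.1 (mem_dualFace.1 hy).1 _ hs
      have h3 := (mem_dualFace.1 hy).2
      rw [inner_sub_right, inner_add_right, inner_smul_right, inner_smul_right, h3] at h2
      linarith
    obtain ⟨u₀, hu₀⟩ := Set.Nonempty.intrinsicInterior (dualFace K z).convex
      ⟨0, (dualFace K z).zero_mem⟩
    obtain ⟨d, hd, hud⟩ := exists_add_mem_orthogonal (dualFace K z) H hD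
      (intrinsicInterior_subset hu₀)
    have hi := add_mem_intrinsicInterior hu₀ hd
    exact ⟨u₀ + d, ⟨hud, (mem_dualFace.1 (intrinsicInterior_subset hi)).1⟩, hi⟩
  · rintro ⟨⟨u, ⟨huH, -⟩, hu⟩, htan⟩ x hxH hx
    refine (htan x hxH ((mem_tangent_iff hz).2 fun y hy => ?_)).1
    have hux : ⟪u, x⟫_ℝ = 0 := (Submodule.mem_orthogonal' H u).1 huH x hxH
    -- `x` is nonnegative on the dual face and zero at its relative interior point `u`, so it is
    -- zero on the whole face.
    obtain ⟨ε, hε, hm⟩ := exists_add_smul_sub_mem hu hy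
    have h1 := (mem_closure_dir_iff hz).1 hx _ hm
    have h2 := (mem_closure_dir_iff hz).1 hx _ hy
    rw [inner_add_left, inner_smul_left, inner_sub_left, hux] at h1
    simp only [conj_trivial] at h1
    nlinarith

end Cones

end ConicSystem

namespace ConicSystem

/-! ### The dual of `K ∩ H` and the sum `K^* + H^⊥` -/

section DualSum

variable {E : Type*} [NormedAddCommGroup E] [InnerProductSpace ℝ E]

/-- Modulo `Hᗮ` the cone `D` is closed under negation, hence already a subspace. -/
theorem exists_sub_mem_orthogonal_of_mem_span {D : PointedCone ℝ E} {H : Submodule ℝ E}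
    (hD : ∀ k ∈ D, ∃ d ∈ D, k + d ∈ Hᗮ) {w : E} (hw : w ∈ Submodule.span ℝ (D : Set E)) :
    ∃ d ∈ D, w - d ∈ Hᗮ := by
  induction hw using Submodule.span_induction with
  | mem x hx => exact ⟨x, hx, by simp⟩
  | zero => exact ⟨0, D.zero_mem, by simp⟩
  | add x y _ _ hx hy =>
    obtain ⟨a, ha, hxa⟩ := hx
    obtain ⟨b, hb, hyb⟩ := hy
    exact ⟨a + b, D.add_mem ha hb, add_sub_add_comm x y a b ▸ Submodule.add_mem _ hxa hyb⟩
  | smul r x _ hx =>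
    obtain ⟨a, ha, hxa⟩ := hx
    rcases le_total 0 r with hr | hr
    · exact ⟨r • a, D.smul_mem hr ha, smul_sub r x a ▸ Submodule.smul_mem _ r hxa⟩
    · obtain ⟨d, hd, had⟩ := hD a ha
      refine ⟨-r • d, D.smul_mem (neg_nonneg.2 hr) hd, ?_⟩
      have h : r • x - -r • d = r • (x - a) + r • (a + d) := by module
      rw [h]
      exact Submodule.add_mem _ (Submodule.smul_mem _ r hxa) (Submodule.smul_mem _ r had)

variable [FiniteDimensional ℝ E]

theorem orthogonal_inf (U V : Submodule ℝ E) : (U ⊓ V)ᗮ = Uᗮ ⊔ Vᗮ := by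
  rw [← Submodule.orthogonal_orthogonal (Uᗮ ⊔ Vᗮ), ← Submodule.inf_orthogonal,
    Submodule.orthogonal_orthogonal, Submodule.orthogonal_orthogonal]

/-- A functional that is nonnegative on `K ∩ H` agrees on `H ∩ ldir(z, K)` with a functional that
is nonnegative on `K ∩ ldir(z, K)`. -/
theorem exists_nonneg_extension {K : ProperCone ℝ E} {z c : E} (hz : z ∈ K) {H : Submodule ℝ E}
    (hzH : z ∈ H) (hc : ∀ p ∈ K, p ∈ H → 0 ≤ ⟪c, p⟫_ℝ) :
    ∃ g : E, (∀ x ∈ H ⊓ ldirSubmodule K hz, ⟪g, x⟫_ℝ = ⟪c, x⟫_ℝ) ∧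
      ∀ p ∈ K, p ∈ ldirSubmodule K hz → 0 ≤ ⟪g, p⟫_ℝ := by
  set L := ldirSubmodule K hz
  obtain ⟨g, hg, hnn⟩ := riesz_extension (K.toPointedCone.comap L.subtype)
    ⟨H.comap L.subtype, ((innerₗ E c).comp L.subtype).domRestrict _⟩
    -- The extension theorem needs every element of `L` to be moved into the cone by an element of
    -- `H`; a multiple of `z` does this.
    (fun x hx => hc _ hx x.2) (fun y => by
      obtain ⟨t, ht⟩ := ((mem_ldir_iff hz).1 y.2).1
      refine ⟨⟨t • ⟨z, self_mem_ldir hz⟩, H.smul_mem t hzH⟩, ?_⟩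
      rw [add_comm]
      exact ht)
  have := FiniteDimensional.complete ℝ L
  refine ⟨((InnerProductSpace.toDual ℝ L).symm (LinearMap.toContinuousLinearMap g) : L), ?_, ?_⟩
  · intro x hx
    have h1 := hg ⟨⟨x, hx.2⟩, hx.1⟩
    have h2 := InnerProductSpace.toDual_symm_apply (𝕜 := ℝ) (E := L) (x := ⟨x, hx.2⟩)
      (y := LinearMap.toContinuousLinearMap g)
    rw [Submodule.coe_inner] at h2
    exact h2.trans h1
  · intro p hp hpL
    have h1 := hnn ⟨p, hpL⟩ hp
    have h2 := InnerProductSpace.toDual_symm_apply (𝕜 := ℝ) (E := L) (x := ⟨p, hpL⟩)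
      (y := LinearMap.toContinuousLinearMap g)
    rw [Submodule.coe_inner] at h2
    exact h1.trans_eq h2.symm

/-- If `K^* + ldir(z, K)^⊥` is closed, it contains the dual of `K ∩ ldir(z, K)`. -/
theorem mem_dualCone_add_of_nonneg {K : ProperCone ℝ E} {z g : E} (hz : z ∈ K)
    (hcl : IsClosed (dualCone K + ((ldirSubmodule K hz)ᗮ : Set E)))
    (hg : ∀ p ∈ K, p ∈ ldirSubmodule K hz → 0 ≤ ⟪g, p⟫_ℝ) :
    g ∈ dualCone K + ((ldirSubmodule K hz)ᗮ : Set E) := by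
  set L := ldirSubmodule K hz
  let C : PointedCone ℝ E :=
    (ProperCone.innerDual (K : Set E)).toPointedCone ⊔ Lᗮ.restrictScalars _
  have hC : (C : Set E) = dualCone K + (Lᗮ : Set E) := Submodule.coe_sup _ _
  rw [← hcl.closure_eq, ← hC, mem_closure_iff_forall_inner_nonneg]
  intro y hy
  rw [real_inner_comm]
  refine hg y ?_ ?_
  · rw [mem_iff_forall_dualCone]
    intro w hw
    rw [real_inner_comm]
    exact hy w (Submodule.mem_sup_left hw)
  · rw [← L.orthogonal_orthogonal, Submodule.mem_orthogonal']
    intro w hw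
    have hsub (v : E) (hv : v ∈ Lᗮ) : v ∈ C := Submodule.mem_sup_right hv
    have h1 := hy w (hsub w hw)
    have h2 := hy (-w) (hsub _ (Submodule.neg_mem _ hw))
    rw [inner_neg_right] at h2
    linarith

/-- Under the tangent condition, `K^* + H^⊥` contains the dual of `K ∩ H`. -/
theorem exists_dualCone_sub_mem_orthogonal {K : ProperCone ℝ E} {z c : E} (hz : z ∈ K)
    {H : Submodule ℝ E} (hzH : z ∈ H)
    (hcl : IsClosed (dualCone K + ((ldirSubmodule K hz)ᗮ : Set E)))
    (hu : ∃ u ∈ (Hᗮ : Set E) ∩ dualCone K, StrictlyComplementary K u z)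
    (htan : (H : Set E) ∩ (tangent z (K : Set E) \ ldir z (K : Set E)) = ∅)
    (hc : ∀ p ∈ K, p ∈ H → 0 ≤ ⟪c, p⟫_ℝ) : ∃ k ∈ dualCone K, c - k ∈ Hᗮ := by
  obtain ⟨u, ⟨huH, -⟩, hu⟩ := hu
  rw [strictlyComplementary_iff hz] at hu
  have hD : ∀ k ∈ dualFace K z, ∃ d ∈ dualFace K z, k + d ∈ Hᗮ := by
    intro k hk
    obtain ⟨ε, hε, h⟩ := exists_add_smul_sub_mem hu hk
    refine ⟨ε⁻¹ • (u + ε • (u - k)), (dualFace K z).smul_mem (inv_nonneg.2 hε.le) h, ?_⟩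
    have h2 : k + ε⁻¹ • (u + ε • (u - k)) = (1 + ε⁻¹) • u := by
      match_scalars <;> field_simp <;> ring
    rw [h2]
    exact Submodule.smul_mem _ _ huH
  obtain ⟨g, hgc, hg⟩ := exists_nonneg_extension hz hzH hc
  obtain ⟨k, hk, l, hl, rfl⟩ := Set.mem_add.1 (mem_dualCone_add_of_nonneg hz hcl hg)
  -- The tangent space is the orthogonal complement of the dual face, so the tangent condition is
  -- this inclusion. Dualized, it splits `c - k` into a part in `Hᗮ` and a part in the span of the
  -- dual face, which `hD` absorbs.
  have hle : H ⊓ (Submodule.span ℝ (dualFace K z : Set E))ᗮ ≤ H ⊓ ldirSubmodule K hz := by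
    rintro x ⟨hxH, hx⟩
    refine ⟨hxH, ?_⟩
    by_contra hxl
    refine Set.eq_empty_iff_forall_notMem.1 htan x ⟨hxH, (mem_tangent_iff hz).2 fun y hy => ?_, hxl⟩
    rw [real_inner_comm]
    exact mem_perp.1 hx y hy
  have hw : c - k ∈ (H ⊓ ldirSubmodule K hz)ᗮ := by
    rw [Submodule.mem_orthogonal']
    intro x hx
    have h1 := hgc x hx
    have h2 := (Submodule.mem_orthogonal' _ l).1 hl x hx.2
    rw [inner_add_left, h2] at h1
    rw [inner_sub_left]
    linarith
  have hw' := Submodule.orthogonal_le hle hw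
  rw [orthogonal_inf, Submodule.orthogonal_orthogonal] at hw'
  obtain ⟨n, hn, s, hs, hns⟩ := Submodule.mem_sup.1 hw'
  obtain ⟨d, hd, hsd⟩ := exists_sub_mem_orthogonal_of_mem_span hD hs
  refine ⟨k + d, (ProperCone.innerDual (K : Set E)).add_mem hk (mem_dualFace.1 hd).1, ?_⟩
  have : c - (k + d) = n + (s - d) := by rw [← sub_sub, ← hns]; abel
  rw [this]
  exact Submodule.add_mem _ hn hsd

theorem mem_closure_image_adjoint_iff {V : Type*} [NormedAddCommGroup V] [InnerProductSpace ℝ V]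
    [FiniteDimensional ℝ V] (C : PointedCone ℝ E) (M : V →ₗ[ℝ] E) {c : V} :
    c ∈ closure (LinearMap.adjoint M '' (C : Set E)) ↔
      ∀ x, (∀ y ∈ C, 0 ≤ ⟪y, M x⟫_ℝ) → 0 ≤ ⟪c, x⟫_ℝ := by
  have := mem_closure_iff_forall_inner_nonneg (C.map (LinearMap.adjoint M)) (x := c)
  rw [PointedCone.coe_map] at this
  rw [this]
  refine forall_congr' fun x => ?_
  rw [real_inner_comm]
  refine imp_congr_left ?_
  simp only [PointedCone.mem_map, forall_exists_index, and_imp, forall_apply_eq_imp_iff₂,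
    LinearMap.adjoint_inner_right, real_inner_comm]

end DualSum

/-! ### Conic systems: duality, closedness and maximum slacks -/

section System

variable {X Y : Type*} [NormedAddCommGroup X] [InnerProductSpace ℝ X]
  [NormedAddCommGroup Y] [InnerProductSpace ℝ Y]
  {A : X →ₗ[ℝ] Y} {b : Y} {K : ProperCone ℝ Y} {z : Y}

theorem inner_toLp_prod (c : X) (v : ℝ) (p : WithLp 2 (X × ℝ)) :
    ⟪(WithLp.toLp 2 (c, v) : WithLp 2 (X × ℝ)), p⟫_ℝ = ⟪c, p.fst⟫_ℝ + v * p.snd := by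
  rw [WithLp.prod_inner_apply]
  simp [mul_comm]

/-- No sign is imposed on `p.snd`. If the inner product were negative, adding `|p.snd| + 1` copies
of a nearly optimal slack would make the last coordinate positive, and rescaling would give a
feasible point with value above `v`. -/
theorem inner_nonneg_of_isLUB {c : X} {v : ℝ}
    (hv : IsLUB ((fun x => ⟪c, x⟫_ℝ) '' feasibleSet A b K) v) {p : WithLp 2 (X × ℝ)}
    (hp : A p.fst + p.snd • b ∈ K) : 0 ≤ ⟪(WithLp.toLp 2 (c, v) : WithLp 2 (X × ℝ)), p⟫_ℝ := by
  rw [inner_toLp_prod]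
  by_contra! hneg
  have hl : 0 < |p.snd| + 1 := by positivity
  have hlt : 0 < |p.snd| + 1 + p.snd := by linarith [neg_abs_le p.snd]
  obtain ⟨_, ⟨x₀, hx₀, rfl⟩, hx₀v⟩ := (lt_isLUB_iff hv).1
    (show v + (⟪c, p.fst⟫_ℝ + v * p.snd) / (|p.snd| + 1) < v by
      linarith [div_neg_of_neg_of_pos hneg hl])
  simp only at hx₀v
  have hx : (|p.snd| + 1 + p.snd)⁻¹ • ((|p.snd| + 1) • x₀ - p.fst) ∈ feasibleSet A b K := by
    refine mem_of_mem_of_eq (K.smul_mem (K.add_mem hp (K.smul_mem hx₀ hl.le))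
      (inv_nonneg.2 hlt.le)) ?_
    rw [map_smul, map_sub, map_smul]
    match_scalars <;> field_simp
    ring
  have h1 := hv.1 ⟨_, hx, rfl⟩
  simp only [inner_smul_right, inner_sub_right] at h1
  rw [inv_mul_le_iff₀ hlt] at h1
  rw [← lt_sub_iff_add_lt', div_lt_iff₀ hl] at hx₀v
  linarith

theorem IsMaximumSlack.mem (hz : IsMaximumSlack A b K z) : z ∈ K ∧ ∃ x : X, z = b - A x := by
  have h : z ∈ {s : Y | s ∈ K ∧ ∃ x : X, s = b - A x} := intrinsicInterior_subset hz
  exact h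

/-- A maximum slack is relatively interior to `K ∩ R(A, b)`. -/
theorem IsMaximumSlack.exists_smul_sub_mem (hz : IsMaximumSlack A b K z) {p : Y} (hp : p ∈ K)
    (hpR : p ∈ LinearMap.range (rowOp A b)) : ∃ t : ℝ, t • z - p ∈ K := by
  obtain ⟨hzK, x₀, hx₀⟩ := hz.mem
  obtain ⟨q, rfl⟩ := hpR
  rw [rowOp_apply] at hp ⊢
  set τ := q.snd
  have hs : 0 < |τ| + 1 := by positivity
  have hst : 0 < |τ| + 1 + τ := by linarith [neg_abs_le τ]
  set σ := |τ| + 1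
  have hw : (σ + τ)⁻¹ • (A q.fst + τ • b + σ • z) ∈ {s : Y | s ∈ K ∧ ∃ x : X, s = b - A x} := by
    refine ⟨K.smul_mem (K.add_mem hp (K.smul_mem hzK hs.le)) (inv_nonneg.2 hst.le),
      (σ + τ)⁻¹ • (σ • x₀ - q.fst), ?_⟩
    rw [map_smul, map_sub, map_smul, hx₀]
    match_scalars <;> field_simp
    ring
  obtain ⟨ε, hε, h, -⟩ := exists_add_smul_sub_mem hz hw
  -- The factor `(σ + τ) / ε` turns the `ε • w` in `z + ε • (z - w)` into `p + σ • z`; this is the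
  -- remaining coefficient of `z`.
  refine ⟨(σ + τ) / ε * (1 + ε) - σ, mem_of_mem_of_eq
    (K.smul_mem h (show 0 ≤ (σ + τ) / ε by positivity)) ?_⟩
  match_scalars <;> field_simp
  all_goals ring

theorem IsMaximumSlack.mem_range (hz : IsMaximumSlack A b K z) :
    z ∈ LinearMap.range (rowOp A b) := by
  obtain ⟨-, x, hx⟩ := hz.mem
  refine ⟨WithLp.toLp 2 (-x, 1), ?_⟩
  rw [rowOp_apply, hx]
  simp [neg_add_eq_sub]

theorem IsMaximumSlack.feasibleSet_nonempty (hz : IsMaximumSlack A b K z) :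
    (feasibleSet A b K).Nonempty := by
  obtain ⟨hzK, x, hx⟩ := hz.mem
  exact ⟨x, mem_of_mem_of_eq hzK hx⟩

variable [FiniteDimensional ℝ Y]

/-- `K^* × ℝ₊` as a convex cone. -/
def dualPointedConeProd (K : ProperCone ℝ Y) : PointedCone ℝ (WithLp 2 (Y × ℝ)) where
  carrier := dualConeProd K
  zero_mem' := ⟨(ProperCone.innerDual (K : Set Y)).zero_mem, le_rfl⟩
  add_mem' hp hq := ⟨(ProperCone.innerDual (K : Set Y)).add_mem hp.1 hq.1, add_nonneg hp.2 hq.2⟩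
  smul_mem' r _ hp := ⟨(ProperCone.innerDual (K : Set Y)).smul_mem hp.1 r.2,
    mul_nonneg r.2 hp.2⟩

theorem forall_dualConeProd_inner_nonneg_iff {p : WithLp 2 (X × ℝ)} :
    (∀ q ∈ dualConeProd K, 0 ≤ ⟪q, blockOp A b p⟫_ℝ) ↔
      A p.fst + p.snd • b ∈ K ∧ 0 ≤ p.snd := by
  simp only [blockOp_apply, WithLp.prod_inner_apply]
  rw [mem_iff_forall_dualCone]
  constructor
  · intro h
    refine ⟨fun y hy => ?_, ?_⟩
    · simpa using h (WithLp.toLp 2 (y, 0)) ⟨hy, le_rfl⟩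
    · simpa using h (WithLp.toLp 2 (0, 1))
        ⟨(ProperCone.innerDual (K : Set Y)).zero_mem, zero_le_one⟩
  · rintro ⟨h1, h2⟩ q ⟨hq1, hq2⟩
    exact add_nonneg (h1 _ hq1) (mul_nonneg h2 hq2)

variable [FiniteDimensional ℝ X]

theorem mem_closure_rowImage_iff {c : WithLp 2 (X × ℝ)} :
    c ∈ closure (LinearMap.adjoint (rowOp A b) '' dualCone K) ↔
      ∀ p : WithLp 2 (X × ℝ), A p.fst + p.snd • b ∈ K → 0 ≤ ⟪c, p⟫_ℝ := by
  refine (mem_closure_image_adjoint_iff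
    (ProperCone.innerDual (K : Set Y)).toPointedCone (rowOp A b)).trans ?_
  refine forall_congr' fun p => imp_congr_left ?_
  rw [mem_iff_forall_dualCone, rowOp_apply]
  rfl

theorem mem_closure_blockImage_iff {c : WithLp 2 (X × ℝ)} :
    c ∈ closure (LinearMap.adjoint (blockOp A b) '' dualConeProd K) ↔
      ∀ p : WithLp 2 (X × ℝ), A p.fst + p.snd • b ∈ K → 0 ≤ p.snd → 0 ≤ ⟪c, p⟫_ℝ := by
  refine (mem_closure_image_adjoint_iff (dualPointedConeProd K) (blockOp A b)).trans ?_
  refine forall_congr' fun p => ?_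
  rw [← and_imp]
  exact imp_congr_left forall_dualConeProd_inner_nonneg_iff

theorem weak_duality {y : Y} (hy : y ∈ dualCone K) {x : X} (hx : x ∈ feasibleSet A b K) :
    ⟪LinearMap.adjoint A y, x⟫_ℝ ≤ ⟪b, y⟫_ℝ := by
  have h := mem_dualCone.1 hy _ hx
  rw [inner_sub_right, real_inner_comm] at h
  rw [LinearMap.adjoint_inner_left]
  linarith

theorem wellBehaved_of_blockImageClosed (h : BlockImageClosed A b K) : WellBehaved A b K := by
  intro c v hv
  have hmem : (WithLp.toLp 2 (c, v) : WithLp 2 (X × ℝ)) ∈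
      closure (LinearMap.adjoint (blockOp A b) '' dualConeProd K) :=
    mem_closure_blockImage_iff.2 fun p hp _ => inner_nonneg_of_isLUB hv hp
  rw [h.closure_eq] at hmem
  obtain ⟨q, ⟨hq1, hq2⟩, hq⟩ := hmem
  rw [adjoint_blockOp_apply] at hq
  have h1 : LinearMap.adjoint A q.fst = c := congrArg WithLp.fst hq
  have h2 : ⟪b, q.fst⟫_ℝ + q.snd = v := congrArg WithLp.snd hq
  -- Weak duality forces the slack `q.snd ≥ 0` to be zero.
  have h3 : v ≤ ⟪b, q.fst⟫_ℝ := by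
    refine hv.2 ?_
    rintro _ ⟨x, hx, rfl⟩
    exact h1 ▸ weak_duality hq1 hx
  exact ⟨q.fst, hq1, h1, by linarith⟩

/-- A supremum pair is nonnegative for either sign of the last coordinate, so it already lies in the
closure of the smaller row image. -/
theorem wellBehaved_of_rowImageClosed (h : RowImageClosed A b K) : WellBehaved A b K := by
  intro c v hv
  have hmem : (WithLp.toLp 2 (c, v) : WithLp 2 (X × ℝ)) ∈
      closure (LinearMap.adjoint (rowOp A b) '' dualCone K) :=
    mem_closure_rowImage_iff.2 fun p hp => inner_nonneg_of_isLUB hv hp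
  rw [h.closure_eq] at hmem
  obtain ⟨y, hy, hyc⟩ := hmem
  rw [adjoint_rowOp_apply] at hyc
  exact ⟨y, hy, congrArg WithLp.fst hyc, congrArg WithLp.snd hyc⟩

theorem blockImageClosed_of_wellBehaved (hP : (feasibleSet A b K).Nonempty)
    (h : WellBehaved A b K) : BlockImageClosed A b K := by
  refine isClosed_of_closure_subset fun g hg => ?_
  rw [mem_closure_blockImage_iff] at hg
  have hle : ∀ x ∈ feasibleSet A b K, ⟪g.fst, x⟫_ℝ ≤ g.snd := by
    intro x hx
    have := hg (WithLp.toLp 2 (-x, 1)) (mem_of_mem_of_eq hx (by simp; abel)) zero_le_one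
    rw [WithLp.prod_inner_apply] at this
    simp at this
    linarith
  have hbdd : BddAbove ((fun x => ⟪g.fst, x⟫_ℝ) '' feasibleSet A b K) := by
    refine ⟨g.snd, ?_⟩
    rintro _ ⟨x, hx, rfl⟩
    exact hle x hx
  have hlub := isLUB_csSup (hP.image _) hbdd
  obtain ⟨y, hy, hyc, hyb⟩ := h g.fst _ hlub
  have hv : ⟪b, y⟫_ℝ ≤ g.snd := by
    rw [hyb]
    refine hlub.2 ?_
    rintro _ ⟨x, hx, rfl⟩
    exact hle x hx
  -- The extra coordinate absorbs the gap between the bound `g.snd` and the supremum.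
  refine ⟨WithLp.toLp 2 (y, g.snd - ⟪b, y⟫_ℝ), ⟨hy, sub_nonneg.2 hv⟩, ?_⟩
  rw [adjoint_blockOp_apply]
  apply WithLp.ofLp_injective
  exact Prod.ext hyc (add_sub_cancel _ _)

/-- Lift `z` to `w` in the cone `D` dual to the block image. There `w` dominates `D`, so `dir(w, D)`
is closed. Closedness of the block image makes every functional in `D^* ∩ w^⊥` come from `K^* ∩
z^⊥`, so closure directions at `z` in the range lift to directions at `w`. -/
theorem frontierCondition_of_blockImageClosed (hz : IsMaximumSlack A b K z)
    (h : BlockImageClosed A b K) : FrontierCondition A b K z := by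
  obtain ⟨hzK, x₀, hx₀⟩ := hz.mem
  set D : ProperCone ℝ (WithLp 2 (X × ℝ)) :=
    ProperCone.innerDual (LinearMap.adjoint (blockOp A b) '' dualConeProd K) with hDdef
  have hD (p : WithLp 2 (X × ℝ)) : p ∈ D ↔ A p.fst + p.snd • b ∈ K ∧ 0 ≤ p.snd := by
    rw [← forall_dualConeProd_inner_nonneg_iff, hDdef, ProperCone.mem_innerDual,
      Set.forall_mem_image]
    simp only [LinearMap.adjoint_inner_left]
  set w : WithLp 2 (X × ℝ) := WithLp.toLp 2 (-x₀, 1) with hwdef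
  have hAw : A w.fst + w.snd • b = z := by
    rw [hx₀]; simp [hwdef, neg_add_eq_sub]
  have hwD : w ∈ D := (hD w).2 ⟨hAw.symm ▸ hzK, zero_le_one⟩
  have hclosed : IsClosed (dir w (D : Set (WithLp 2 (X × ℝ)))) := by
    refine isClosed_dir_of_forall_exists hwD fun p hp => ?_
    obtain ⟨hpK, hp0⟩ := (hD p).1 hp
    obtain ⟨t, ht⟩ := hz.exists_smul_sub_mem hpK ⟨p, rowOp_apply A b p⟩
    -- `t` secures the `K`-constraint and `p.snd` the sign of the last coordinate.
    refine ⟨max t p.snd, (hD _).2 ⟨?_, ?_⟩⟩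
    · refine mem_of_mem_of_eq (K.add_mem ht (K.smul_mem hzK
        (sub_nonneg.2 (le_max_left t p.snd)))) ?_
      simp only [WithLp.sub_fst, WithLp.smul_fst, WithLp.sub_snd, WithLp.smul_snd, map_sub,
        map_smul, ← hAw]
      module
    · simp [hwdef]
  refine Set.eq_empty_iff_forall_notMem.2 ?_
  rintro _ ⟨⟨p, rfl⟩, hcl, hnot⟩
  refine hnot ?_
  have hpcl : p ∈ closure (dir w (D : Set (WithLp 2 (X × ℝ)))) := by
    rw [mem_closure_dir_iff hwD]
    intro g hg
    obtain ⟨hgD, hgw⟩ := mem_dualFace.1 hg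
    have hgmem : g ∈ closure (LinearMap.adjoint (blockOp A b) '' dualConeProd K) :=
      mem_closure_blockImage_iff.2 fun q hq hq0 => mem_dualCone.1 hgD q ((hD q).2 ⟨hq, hq0⟩)
    rw [h.closure_eq] at hgmem
    obtain ⟨q, ⟨hq1, hq2⟩, rfl⟩ := hgmem
    rw [LinearMap.adjoint_inner_left, blockOp_apply, WithLp.prod_inner_apply] at hgw ⊢
    rw [hAw] at hgw
    have h1 := mem_dualCone.1 hq1 z hzK
    have h2 : ⟪q.fst, z⟫_ℝ + q.snd = 0 := by simpa [hwdef] using hgw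
    have h3 := (mem_closure_dir_iff hzK).1 hcl q.fst (mem_dualFace.2 ⟨hq1, by linarith⟩)
    have h4 : q.snd = 0 := by linarith
    rw [rowOp_apply] at h3
    simpa [h4] using h3
  rw [hclosed.closure_eq] at hpcl
  obtain ⟨ε, hε, hp⟩ := hpcl
  refine ⟨ε, hε, mem_of_mem_of_eq ((hD _).1 hp).1 ?_⟩
  simp only [WithLp.add_fst, WithLp.smul_fst, WithLp.add_snd, WithLp.smul_snd, map_add,
    map_smul, ← hAw, rowOp_apply]
  module

theorem frontierCondition_iff_tangentCondition (hz : IsMaximumSlack A b K z) :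
    FrontierCondition A b K z ↔ TangentCondition A b K z := by
  rw [FrontierCondition, TangentCondition, ← LinearMap.orthogonal_range]
  exact frontier_iff_tangent hz.mem.1 hz.mem_range fun p hp hpR => hz.exists_smul_sub_mem hp hpR

theorem rowImageClosed_of_tangentCondition (hz : IsMaximumSlack A b K z)
    (hcl : IsClosed (dualCone K + (perp (minimalFace (K : Set Y) z) : Set Y)))
    (h : TangentCondition A b K z) : RowImageClosed A b K := by
  rw [TangentCondition, ← LinearMap.orthogonal_range] at h
  rw [perp_minimalFace hz.mem.1] at hcl
  refine isClosed_of_closure_subset fun c hc => ?_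
  -- The range is a closed subspace, so a limit point is again the image of some `y`, and it tests
  -- only `K ∩ H`.
  obtain ⟨y, rfl⟩ : c ∈ LinearMap.range (LinearMap.adjoint (rowOp A b)) :=
    closure_minimal (Set.image_subset_range _ _)
      (Submodule.closed_of_finiteDimensional (LinearMap.range (LinearMap.adjoint (rowOp A b)))) hc
  rw [mem_closure_rowImage_iff] at hc
  obtain ⟨k, hk, hyk⟩ := exists_dualCone_sub_mem_orthogonal hz.mem.1 hz.mem_range hcl h.1 h.2
    (c := y) (by
      rintro _ hp ⟨p, rfl⟩
      rw [← LinearMap.adjoint_inner_left]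
      exact hc p (rowOp_apply A b p ▸ hp))
  rw [LinearMap.orthogonal_range, LinearMap.mem_ker, map_sub, sub_eq_zero] at hyk
  exact ⟨k, hk, hyk.symm⟩

end System

end ConicSystem

theorem theorem2p1 {X Y : Type*}
    [NormedAddCommGroup X] [InnerProductSpace ℝ X] [FiniteDimensional ℝ X]
    [NormedAddCommGroup Y] [InnerProductSpace ℝ Y] [FiniteDimensional ℝ Y]
    (A : X →ₗ[ℝ] Y) (b : Y) (K : ProperCone ℝ Y) (z : Y)
    (hz : ConicSystem.IsMaximumSlack A b K z) :
    (ConicSystem.WellBehaved A b K ↔ ConicSystem.BlockImageClosed A b K) ∧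
    (ConicSystem.RowImageClosed A b K → ConicSystem.BlockImageClosed A b K) ∧
    (ConicSystem.BlockImageClosed A b K → ConicSystem.FrontierCondition A b K z) ∧
    (ConicSystem.FrontierCondition A b K z ↔ ConicSystem.TangentCondition A b K z) ∧
    (IsClosed (ConicSystem.dualCone K +
        (ConicSystem.perp (ConicSystem.minimalFace (K : Set Y) z) : Set Y)) →
      List.TFAE [
        ConicSystem.WellBehaved A b K,
        ConicSystem.BlockImageClosed A b K,
        ConicSystem.RowImageClosed A b K,
        ConicSystem.FrontierCondition A b K z,
        ConicSystem.TangentCondition A b K z]) := by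
  have h21 := ConicSystem.wellBehaved_of_blockImageClosed (A := A) (b := b) (K := K)
  have h12 := ConicSystem.blockImageClosed_of_wellBehaved (A := A) hz.feasibleSet_nonempty
  have h31 := ConicSystem.wellBehaved_of_rowImageClosed (A := A) (b := b) (K := K)
  have h24 := ConicSystem.frontierCondition_of_blockImageClosed hz
  have h45 := ConicSystem.frontierCondition_iff_tangentCondition hz
  refine ⟨⟨h12, h21⟩, fun h => h12 (h31 h), h24, h45, fun hcl => ?_⟩
  have h53 := ConicSystem.rowImageClosed_of_tangentCondition hz hcl
  tfae_have 1 → 2 := h12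
  tfae_have 2 → 4 := h24
  tfae_have 4 ↔ 5 := h45
  tfae_have 5 → 3 := h53
  tfae_have 3 → 1 := h31
  tfae_finish
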